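/- An order is a commutative ring (with $1$) whose additive group is isomorphic to $\mathbb{Z}^n$ for some integer $n\ge 0$; it is reduced if it has no nonzero nilpotent elements. For a multiplicatively written abelian group $\Gamma$, a $\Gamma$-grading of a commutative ring $A$ is a family $\mathbf{B}=(B_\gamma)_{\gamma\in\Gamma}$ of additive subgroups of $A$ such that $B_\gamma\cdot B_{\gamma'}\subset B_{\gamma\gamma'}$ for all $\gamma,\gamma'\in\Gamma$ and such that the summation map $\bigoplus_{\gamma\in\Gamma}B_\gamma\to A$ is bijective. For a homomorphism $f:\Gamma\to\Delta$ of abelian groups, put $f_*\mathbf{B}=\bigl(\sum_{\gamma\in f^{-1}(\delta)}B_\gamma\bigr)_{\delta\in\Delta}$. A universal grading of $A$ is a pair $(\Gamma,\mathbf{B})$, with $\Gamma$ an abelian group and $\mathbf{B}$ a $\Gamma$-grading of $A$, such that for every abelian group $\Delta$ and every $\Delta$-grading $\mathbf{C}$ of $A$ there is a unique group homomorphism $f:\Gamma\to\Delta$ with $\mathbf{C}=f_*\mathbf{B}$. **Theorem.** Every reduced order $A$ has a universal grading, and for every universal grading $(\Gamma,\mathbf{B})$ of $A$ the group $\Gamma$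 is finite. -/

import Mathlib

universe u v w

namespace RingGrading

/-- An order: a commutative ring whose additive group is isomorphic to `ℤ ^ n` for some `n ≥ 0`. -/
def IsOrder (A : Type u) [CommRing A] : Prop :=
  ∃ n : ℕ, Nonempty (A ≃+ (Fin n → ℤ))

open scoped Classical in
/-- A grading of a commutative ring `A` by a multiplicatively written abelian group `Γ`:
a family of additive subgroups, compatible with multiplication, such that the summation map
from their (external) direct sum to `A` is bijective. -/
structure IsGrading {A : Type u} [CommRing A] {Γ : Type v} [CommGroup Γ]
    (B : Γ → AddSubgroup A) : Prop where
  mul_mem : ∀ (γ γ' : Γ) (x y : A), x ∈ B γ → y ∈ B γ' → x * y ∈ B (γ * γ')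
  isInternal : DirectSum.IsInternal B

/-- The family `f_* B`, whose piece at `δ` is the sum of the `B γ` with `f γ = δ`. -/
def pushforward {A : Type u} [CommRing A] {Γ : Type v} [CommGroup Γ] {Δ : Type w} [CommGroup Δ]
    (f : Γ →* Δ) (B : Γ → AddSubgroup A) : Δ → AddSubgroup A :=
  fun δ => ⨆ (γ : Γ) (_ : f γ = δ), B γ

/-- `(Γ, B)` is a universal grading of `A` (tested against abelian groups in `Type w`). -/
def IsUniversalGrading {A : Type u} [CommRing A] {Γ : Type v} [CommGroup Γ]
    (B : Γ → AddSubgroup A) : Prop :=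
  IsGrading B ∧
    ∀ (Δ : Type w) [CommGroup Δ] (C : Δ → AddSubgroup A), IsGrading C →
      ∃! f : Γ →* Δ, C = pushforward f B

end RingGrading

/-! The real part of `∑ σ x * conj (σ y)`, over all ring homomorphisms `σ : A → ℂ`, is a positive
definite form on `A` with finitely many elements below each bound. Every grading is orthogonal for
it: twisting by a circle-valued character `χ` of the grading group permutes the `σ`, while it
multiplies the sum for `x`, `y` of degrees `γ ≠ δ` by `χ γ * conj (χ δ)`, which differs from `1` for
a suitable `χ` (`IsGrading.isOrtho`).

By Eichler's argument such a lattice has a finest orthogonal decomposition `L`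
(`IsPosDefForm.exists_finest`), so every grading is a coarsening of `L`. The universal group is the
abelian group on the indices of `L` with just the relations that multiplication forces
(`IsPosDefForm.isGrading_coarsen`, `IsPosDefForm.existsUnique_pushforward`).

It is finite because `L` has finitely many pieces and, `A` being reduced, powers of a nonzero
homogeneous element stay nonzero, so degrees are torsion. Any other universal grading group is a
quotient of this one, since its support generates it. -/

namespace RingGrading

/-! ### Orthogonal decompositions of a positive definite lattice -/

section Lattice

variable {M : Type u} [AddCommGroup M] {β : M →+ M →+ ℝ}

/-- The members of the family `L` are pairwise orthogonal for `β`. -/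
def IsOrtho {κ : Type v} (β : M →+ M →+ ℝ) (L : κ → AddSubgroup M) : Prop :=
  ∀ i j, i ≠ j → ∀ x ∈ L i, ∀ y ∈ L j, β x y = 0

/-- A symmetric, positive definite form. -/
structure IsPosDefForm (β : M →+ M →+ ℝ) : Prop where
  symm : ∀ x y, β x y = β y x
  pos : ∀ x, x ≠ 0 → 0 < β x x

lemma IsPosDefForm.eq_zero (hβ : IsPosDefForm β) {x : M} (h : β x x = 0) : x = 0 := by
  by_contra hx
  exact (hβ.pos x hx).ne' h

lemma form_eq_zero_of_mem_biSup_right {κ : Type v} {L : κ → AddSubgroup M} {p : κ → Prop}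
    {x y : M} (hy : y ∈ ⨆ (i) (_ : p i), L i)
    (h : ∀ i, p i → ∀ z ∈ L i, β x z = 0) : β x y = 0 := by
  have : (⨆ (i) (_ : p i), L i) ≤ (β x).ker :=
    iSup₂_le fun i hi z hz => (AddMonoidHom.mem_ker).2 (h i hi z hz)
  exact (AddMonoidHom.mem_ker).1 (this hy)

lemma form_eq_zero_of_mem_biSup {κ κ' : Type*} {L : κ → AddSubgroup M} {L' : κ' → AddSubgroup M}
    {p : κ → Prop} {p' : κ' → Prop} (hβ : IsPosDefForm β)
    {x y : M} (hx : x ∈ ⨆ (i) (_ : p i), L i) (hy : y ∈ ⨆ (i) (_ : p' i), L' i)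
    (h : ∀ i j, p i → p' j → ∀ z ∈ L i, ∀ t ∈ L' j, β z t = 0) : β x y = 0 := by
  refine form_eq_zero_of_mem_biSup_right hy fun j hj t ht => ?_
  rw [hβ.symm]
  refine form_eq_zero_of_mem_biSup_right hx fun i hi z hz => ?_
  rw [hβ.symm]
  exact h i j hi hj z hz t ht

lemma exists_add_of_iSup_eq_top {κ : Type v} {L : κ → AddSubgroup M} (h : ⨆ i, L i = ⊤)
    (p : κ → Prop) (x : M) :
    ∃ a ∈ ⨆ (i) (_ : p i), L i, ∃ b ∈ ⨆ (i) (_ : ¬ p i), L i, a + b = x := by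
  have hx : x ∈ (⨆ (i) (_ : p i), L i) ⊔ ⨆ (i) (_ : ¬ p i), L i := by
    have : (⨆ i, L i) ≤ (⨆ (i) (_ : p i), L i) ⊔ ⨆ (i) (_ : ¬ p i), L i := by
      refine iSup_le fun i => ?_
      by_cases hi : p i
      · exact le_sup_of_le_left (le_iSup₂_of_le i hi le_rfl)
      · exact le_sup_of_le_right (le_iSup₂_of_le i hi le_rfl)
    exact this (h ▸ AddSubgroup.mem_top x)
  exact AddSubgroup.mem_sup.1 hx

/-- Write `x = a + b` along `p` and its complement: `b` is orthogonal to both `x` and `a`, hence to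
itself. This turns orthogonality into membership. -/
lemma IsPosDefForm.mem_biSup (hβ : IsPosDefForm β) {κ : Type v} {L : κ → AddSubgroup M}
    (hL : IsOrtho β L) (h : ⨆ i, L i = ⊤) {p : κ → Prop} {x : M}
    (hx : ∀ i, ¬ p i → ∀ z ∈ L i, β x z = 0) : x ∈ ⨆ (i) (_ : p i), L i := by
  obtain ⟨a, ha, b, hb, rfl⟩ := exists_add_of_iSup_eq_top h p x
  have h1 : β (a + b) b = 0 := form_eq_zero_of_mem_biSup_right hb hx
  have h2 : β a b = 0 := form_eq_zero_of_mem_biSup hβ ha hb fun i j hi hj z hz t ht =>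
    hL i j (by rintro rfl; exact hj hi) z hz t ht
  have h3 : b = 0 := hβ.eq_zero (by simpa [h2] using h1)
  simpa [h3] using ha

lemma IsPosDefForm.eq_of_le (hβ : IsPosDefForm β) {κ : Type v} {L C : κ → AddSubgroup M}
    (hC : IsOrtho β C) (h : ⨆ i, L i = ⊤) (hle : ∀ i, L i ≤ C i) : C = L := by
  funext k
  refine le_antisymm (fun x hx => ?_) (hle k)
  have hL : IsOrtho β L := fun i j hij x hx y hy => hC i j hij x (hle i hx) y (hle j hy)
  have := hβ.mem_biSup hL h (p := fun i => i = k) (x := x)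
    fun i hi z hz => hC k i (Ne.symm hi) x hx z (hle i hz)
  simpa using this

open scoped Classical in
lemma isInternal_of_iSupIndep {κ : Type v} {L : κ → AddSubgroup M} (hi : iSupIndep L)
    (h : ⨆ i, L i = ⊤) : DirectSum.IsInternal L := by
  refine ⟨hi.dfinsuppSumAddHom_injective, ?_⟩
  rw [← AddMonoidHom.range_eq_top, eq_top_iff, ← h]
  refine iSup_le fun i x hx => ⟨DirectSum.of (fun i => L i) i ⟨x, hx⟩, ?_⟩
  simp

open scoped Classical in
lemma iSup_eq_top_of_isInternal {κ : Type v} {L : κ → AddSubgroup M}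
    (h : DirectSum.IsInternal L) : ⨆ i, L i = ⊤ := by
  rw [eq_top_iff]
  intro x _
  obtain ⟨d, rfl⟩ := h.2 x
  induction d using DirectSum.induction_on with
  | zero => simp
  | of i x => simpa using (le_iSup L i) x.2
  | add a b ha hb => simpa using add_mem (ha trivial) (hb trivial)

open scoped Classical in
lemma IsPosDefForm.isInternal (hβ : IsPosDefForm β) {κ : Type v} {L : κ → AddSubgroup M}
    (hL : IsOrtho β L) (h : ⨆ i, L i = ⊤) : DirectSum.IsInternal L := by
  refine isInternal_of_iSupIndep (fun i => ?_) h
  rw [AddSubgroup.disjoint_def]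
  intro x hx hx'
  exact hβ.eq_zero (form_eq_zero_of_mem_biSup_right hx' fun j hj z hz => hL i j hj.symm x hx z hz)

/-- The nonzero `x` admitting no decomposition `x = y + z` with `y, z ≠ 0` and `β y z ≥ 0`. -/
def indecomposables (β : M →+ M →+ ℝ) : Set M :=
  {x | x ≠ 0 ∧ ∀ y z, x = y + z → 0 ≤ β y z → y = 0 ∨ z = 0}

/-- Descent: if `x = y + z` with `y, z ≠ 0` and `β y z ≥ 0`, both parts are strictly shorter than
`x`. As `β` is real-valued, the induction runs on the number of elements no longer than `x`. -/
lemma IsPosDefForm.closure_indecomposables (hβ : IsPosDefForm β)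
    (hfin : ∀ c : ℝ, {x | β x x ≤ c}.Finite) :
    AddSubgroup.closure (indecomposables β) = ⊤ := by
  let m : M → ℕ := fun x => {y | β y y ≤ β x x}.ncard
  have hm : ∀ x y, β x x < β y y → m x < m y := fun x y hxy =>
    Set.ncard_lt_ncard ⟨fun z (hz : _ ≤ _) => hz.trans hxy.le,
      fun hsub => absurd (hsub (le_refl (β y y) : y ∈ {z | β z z ≤ β y y})) (not_le.2 hxy)⟩ (hfin _)
  have key : ∀ (n : ℕ) (x : M), m x = n → x ∈ AddSubgroup.closure (indecomposables β) := by
    intro n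
    induction n using Nat.strong_induction_on with
    | _ n ih =>
      rintro x rfl
      by_cases hx : x ∈ indecomposables β
      · exact AddSubgroup.subset_closure hx
      by_cases hx0 : x = 0
      · simp [hx0]
      have : ∃ y z, x = y + z ∧ 0 ≤ β y z ∧ y ≠ 0 ∧ z ≠ 0 := by
        by_contra! hc
        exact hx ⟨hx0, fun y z h1 h2 => or_iff_not_imp_left.2 (hc y z h1 h2)⟩
      obtain ⟨y, z, rfl, hyz, hy, hz⟩ := this
      have e : β (y + z) (y + z) = β y y + β z z + 2 * β y z := by
        simp [hβ.symm z y]; ring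
      have py := hβ.pos y hy
      have pz := hβ.pos z hz
      exact add_mem (ih _ (hm _ _ (by linarith)) y rfl) (ih _ (hm _ _ (by linarith)) z rfl)
  exact eq_top_iff.2 fun x _ => key _ x rfl

/-- Splitting off the component in `C k` gives `x = a + b` with `β a b = 0`, so one part vanishes;
choosing `k` with `x` not orthogonal to `C k` excludes `a = 0`. -/
lemma IsPosDefForm.mem_of_indecomposable (hβ : IsPosDefForm β) {κ : Type v}
    {C : κ → AddSubgroup M} (hC : IsOrtho β C) (h : ⨆ i, C i = ⊤) {x : M}
    (hx : x ∈ indecomposables β) : ∃ k, x ∈ C k := by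
  have : ∃ k, ∃ z ∈ C k, β x z ≠ 0 := by
    by_contra! hc
    have := hβ.mem_biSup hC h (p := fun _ => False) (x := x) fun i _ => hc i
    exact hx.1 (by simpa using this)
  obtain ⟨k, z, hz, hxz⟩ := this
  obtain ⟨a, ha, b, hb, rfl⟩ := exists_add_of_iSup_eq_top h (fun i => i = k) x
  have hab : β a b = 0 := form_eq_zero_of_mem_biSup hβ ha hb fun i j hi hj z hz t ht =>
    hC i j (by rintro rfl; exact hj hi) z hz t ht
  have ha' : a ∈ C k := by simpa using ha
  rcases hx.2 a b rfl hab.ge with rfl | rfl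
  · refine absurd ?_ hxz
    rw [zero_add, hβ.symm]
    exact form_eq_zero_of_mem_biSup_right hb fun i hi t ht => hC k i (Ne.symm hi) z hz t ht
  · exact ⟨k, by simpa using ha'⟩

/-- Two indecomposable elements are linked when they lie in a chain of successively
non-orthogonal ones. -/
def linkSetoid (β : M →+ M →+ ℝ) : Setoid (indecomposables β) :=
  Relation.EqvGen.setoid fun x y => β x y ≠ 0

/-- The subgroup generated by a class of linked indecomposable elements. -/
def component (β : M →+ M →+ ℝ) (i : Quotient (linkSetoid β)) : AddSubgroup M :=
  AddSubgroup.closure ((↑) '' {x : indecomposables β | Quotient.mk (linkSetoid β) x = i})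

lemma iSup_component (h : AddSubgroup.closure (indecomposables β) = ⊤) :
    ⨆ i, component β i = ⊤ := by
  rw [eq_top_iff, ← h, AddSubgroup.closure_le]
  intro x hx
  exact le_iSup (component β) (Quotient.mk _ ⟨x, hx⟩)
    (AddSubgroup.subset_closure ⟨⟨x, hx⟩, rfl, rfl⟩)

lemma component_ne_bot (i : Quotient (linkSetoid β)) : component β i ≠ ⊥ := by
  obtain ⟨x, rfl⟩ := Quotient.exists_rep i
  intro h
  have : (x : M) ∈ component β (Quotient.mk _ x) := AddSubgroup.subset_closure ⟨x, rfl, rfl⟩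
  rw [h, AddSubgroup.mem_bot] at this
  exact x.2.1 this

lemma isOrtho_component : IsOrtho β (component β) := by
  intro i j hij x hx y hy
  have h1 : ∀ x ∈ ((↑) '' {x : indecomposables β | Quotient.mk (linkSetoid β) x = i} : Set M),
      ∀ y ∈ component β j, β x y = 0 := by
    rintro _ ⟨x, rfl, rfl⟩ y hy
    have : component β j ≤ (β x).ker := by
      refine (AddSubgroup.closure_le _).2 ?_
      rintro _ ⟨y, rfl, rfl⟩
      by_contra hc
      exact hij (Quotient.sound (Relation.EqvGen.rel _ _ hc))
    exact this hy
  have h2 : component β i ≤ (β.flip y).ker :=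
    (AddSubgroup.closure_le _).2 fun x hx => h1 x hx y hy
  exact h2 hx

/-- Non-orthogonal indecomposables cannot lie in different pieces of `C`, so the piece is constant
along chains. -/
lemma IsPosDefForm.exists_component_le (hβ : IsPosDefForm β) {κ : Type v}
    {C : κ → AddSubgroup M} (hC : IsOrtho β C) (h : ⨆ i, C i = ⊤) (i : Quotient (linkSetoid β)) :
    ∃ k, component β i ≤ C k := by
  choose d hd using fun x : indecomposables β => hβ.mem_of_indecomposable hC h x.2
  have hconst : ∀ x y, linkSetoid β x y → d x = d y := by
    intro x y hxy
    induction hxy with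
    | rel x y h =>
      by_contra hne
      exact h (hC _ _ hne x (hd x) y (hd y))
    | refl x => rfl
    | symm x y _ ih => exact ih.symm
    | trans x y z _ _ ih1 ih2 => exact ih1.trans ih2
  obtain ⟨x, rfl⟩ := Quotient.exists_rep i
  refine ⟨d x, (AddSubgroup.closure_le _).2 ?_⟩
  rintro _ ⟨y, hy, rfl⟩
  rw [← hconst y x (Quotient.exact hy)]
  exact hd y

lemma IsPosDefForm.finite_of_isOrtho [Module.Finite ℤ M] (hβ : IsPosDefForm β) {κ : Type v}
    {L : κ → AddSubgroup M} (hL : IsOrtho β L) (hne : ∀ i, L i ≠ ⊥) : Finite κ := by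
  choose x hx hx0 using fun i => (AddSubgroup.ne_bot_iff_exists_ne_zero.1 (hne i)).elim
    fun x hx => (⟨x.1, x.2, fun h => hx (Subtype.ext h)⟩ : ∃ y, y ∈ L i ∧ y ≠ 0)
  have : LinearIndependent ℤ x := by
    rw [linearIndependent_iff']
    intro s g hg i hi
    have h1 : β (x i) (∑ j ∈ s, g j • x j) = g i * β (x i) (x i) := by
      rw [map_sum, Finset.sum_eq_single i]
      · simp
      · intro j _ hj
        simp [hL i j hj.symm _ (hx i) _ (hx j)]
      · exact fun h => absurd hi h
    rw [hg, map_zero] at h1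
    have := (mul_eq_zero.1 h1.symm).resolve_right (hβ.pos _ (hx0 i)).ne'
    exact_mod_cast this
  exact this.finite

/-- A positive definite lattice has a finest orthogonal decomposition, and it is finite. -/
theorem IsPosDefForm.exists_finest [Module.Finite ℤ M] (hβ : IsPosDefForm β)
    (hfin : ∀ c : ℝ, {x | β x x ≤ c}.Finite) :
    ∃ (ι : Type v) (_ : Finite ι) (L : ι → AddSubgroup M), IsOrtho β L ∧ ⨆ i, L i = ⊤ ∧
      (∀ i, L i ≠ ⊥) ∧ ∀ (κ : Type w) (C : κ → AddSubgroup M), IsOrtho β C → ⨆ k, C k = ⊤ →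
        ∀ i, ∃ k, L i ≤ C k := by
  have hfinite := hβ.finite_of_isOrtho isOrtho_component component_ne_bot
  obtain ⟨n, ⟨e⟩⟩ := hfinite.exists_equiv_fin
  let e' : ULift.{v} (Fin n) ≃ Quotient (linkSetoid β) := Equiv.ulift.trans e.symm
  refine ⟨ULift.{v} (Fin n), inferInstance, fun i => component β (e' i), ?_, ?_, ?_, ?_⟩
  · exact fun i j hij => isOrtho_component _ _ (e'.injective.ne hij)
  · rw [e'.iSup_comp (g := component β)]
    exact iSup_component (hβ.closure_indecomposables hfin)
  · exact fun i => component_ne_bot _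
  · exact fun κ C hC h i => hβ.exists_component_le hC h _

end Lattice

/-! ### The canonical form on a reduced order -/

section Order

variable {A : Type u} [CommRing A]

/-- By Dedekind, the homomorphisms are linearly independent; they stay so after restriction to a
finite generating set, which lands in a finite-dimensional space. -/
lemma finite_ringHom_complex [Module.Finite ℤ A] : Finite (A →+* ℂ) := by
  have hli : LinearIndependent ℂ (fun σ : A →+* ℂ => (σ : A → ℂ)) :=
    (linearIndependent_monoidHom A ℂ).comp (fun σ : A →+* ℂ => (σ : A →* ℂ))
      fun σ τ h => RingHom.ext fun x => DFunLike.congr_fun h x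
  obtain ⟨s, hs⟩ := Module.Finite.fg_top (R := ℤ) (M := A)
  let r : (A → ℂ) →ₗ[ℂ] (s → ℂ) := LinearMap.funLeft ℂ ℂ (↑)
  have : LinearIndependent ℂ (r ∘ fun σ : A →+* ℂ => (σ : A → ℂ)) := by
    rw [linearIndependent_iff'] at hli ⊢
    intro t g hg
    refine hli t g ?_
    let φ : A →ₗ[ℤ] ℂ := ∑ σ ∈ t, g σ • (σ : A →+ ℂ).toIntLinearMap
    have hφ : φ = 0 := by
      refine LinearMap.ext_on (s := (s : Set A)) hs fun x hx => ?_
      have := congrFun hg ⟨x, hx⟩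
      simpa [φ, r, LinearMap.funLeft] using this
    funext x
    have := LinearMap.congr_fun hφ x
    simpa [φ] using this
  exact this.finite

/-- In a reduced ring that is finite and torsion-free over `ℤ`, the homomorphisms to `ℂ` separate
the elements from `0`. -/
lemma exists_ringHom_complex_ne_zero [IsReduced A] [Module.Finite ℤ A] [Module.IsTorsionFree ℤ A]
    {x : A} (hx : x ≠ 0) : ∃ σ : A →+* ℂ, σ x ≠ 0 := by
  have hnt : Nontrivial A := ⟨x, 0, hx⟩
  -- A prime `P` avoiding both `x` and the nonzero integers makes `A ⧸ P` a domain, algebraic over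
  -- `ℤ` and of characteristic zero, which embeds in `ℂ` without killing `x`.
  let S : Submonoid A :=
    (nonZeroDivisors ℤ).map (algebraMap ℤ A) ⊔ Submonoid.powers x
  have h0 : (0 : A) ∉ S := by
    intro h
    obtain ⟨_, ⟨n, hn, rfl⟩, _, ⟨k, rfl⟩, h⟩ := Submonoid.mem_sup.1 h
    have hn0 : n ≠ 0 := nonZeroDivisors.ne_zero hn
    have h' : n • x ^ k = 0 := by rw [Algebra.smul_def]; exact h
    exact pow_ne_zero k hx ((smul_eq_zero.1 h').resolve_left hn0)
  obtain ⟨P, hP, -, hdis⟩ := Ideal.exists_le_prime_disjoint (⊥ : Ideal A) S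
    (Set.disjoint_left.2 fun y hy hyS => h0 (by rwa [(Ideal.mem_bot.1 hy)] at hyS))
  have hinj : Function.Injective (algebraMap ℤ (A ⧸ P)) := by
    rw [injective_iff_map_eq_zero]
    intro n hn
    by_contra hn0
    have hnP : algebraMap ℤ A n ∈ P := Ideal.Quotient.eq_zero_iff_mem.1 hn
    exact Set.disjoint_left.1 hdis hnP
      (Submonoid.mem_sup_left ⟨n, mem_nonZeroDivisors_of_ne_zero hn0, rfl⟩)
  have : FaithfulSMul ℤ (A ⧸ P) := (faithfulSMul_iff_algebraMap_injective _ _).2 hinj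
  have : Algebra.IsIntegral ℤ (A ⧸ P) := inferInstance
  have : Algebra.IsAlgebraic ℤ (A ⧸ P) := inferInstance
  let f : (A ⧸ P) →ₐ[ℤ] ℂ := IsAlgClosed.lift
  have hf : Function.Injective f := by
    rw [injective_iff_map_eq_zero]
    intro y hy
    by_contra hy0
    obtain ⟨n, hn0, z, hz⟩ := (Algebra.IsAlgebraic.isAlgebraic (R := ℤ) y).exists_nonzero_dvd
      (mem_nonZeroDivisors_of_ne_zero hy0)
    have := congrArg f hz
    rw [AlgHom.commutes, map_mul, hy, zero_mul] at this
    exact hn0 ((algebraMap ℤ ℂ).injective_int (by simpa using this))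
  refine ⟨f.toRingHom.comp (Ideal.Quotient.mk P), fun h => ?_⟩
  have h1 : Ideal.Quotient.mk P x = 0 := hf (by simpa using h)
  exact Set.disjoint_left.1 hdis (Ideal.Quotient.eq_zero_iff_mem.1 h1)
    (Submonoid.mem_sup_right (Submonoid.mem_powers x))

/-- The sum of an element's images under all homomorphisms to `ℂ` is an integer. -/
lemma exists_int_eq_sum_ringHom [Module.Finite ℤ A] [Fintype (A →+* ℂ)] (x : A) :
    ∃ n : ℤ, ∑ σ : A →+* ℂ, σ x = n := by
  -- All images are algebraic, and the Galois group of `K` permutes the homomorphisms `A → K`; the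
  -- sum is thus rational, and integral over `ℤ`.
  let K := algebraicClosure ℚ ℂ
  have hint : ∀ (σ : A →+* ℂ) (y : A), IsIntegral ℤ (σ y) := fun σ y =>
    (Algebra.IsIntegral.isIntegral (R := ℤ) y).map σ.toIntAlgHom
  have hmem : ∀ (σ : A →+* ℂ) (y : A), σ y ∈ K := fun σ y =>
    mem_algebraicClosure_iff.2 ((hint σ y).tower_top (A := ℚ)).isAlgebraic
  let e : (A →+* ℂ) ≃ (A →+* K) :=
    { toFun := fun σ => σ.codRestrict K.toSubring (hmem σ)
      invFun := fun τ => (algebraMap K ℂ).comp τ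
      left_inv := fun σ => rfl
      right_inv := fun τ => rfl }
  let : Fintype (A →+* K) := Fintype.ofEquiv _ e
  have hsum : ∑ σ : A →+* ℂ, σ x = ((∑ τ : A →+* K, τ x : K) : ℂ) := by
    rw [← e.sum_comp]
    push_cast
    rfl
  have hgal : IsGalois ℚ K :=
    have : IsAlgClosure ℚ K := algebraicClosure.isAlgClosure ℚ ℂ
    IsAlgClosure.isGalois ℚ K
  have hfix : ∀ g : Gal(K/ℚ), g (∑ τ : A →+* K, τ x) = ∑ τ : A →+* K, τ x := by
    intro g
    rw [map_sum]
    let ge : (A →+* K) ≃ (A →+* K) :=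
      { toFun := fun τ => (g : K →+* K).comp τ
        invFun := fun τ => (g.symm : K →+* K).comp τ
        left_inv := fun τ => by ext; simp
        right_inv := fun τ => by ext; simp }
    exact ge.sum_comp (fun τ => τ x)
  obtain ⟨q, hq⟩ := (InfiniteGalois.mem_range_algebraMap_iff_fixed _).2 hfix
  have hqC : ∑ σ : A →+* ℂ, σ x = algebraMap ℚ ℂ q := by
    rw [hsum, ← hq]; rfl
  have hqi : IsIntegral ℤ q := by
    have : IsIntegral ℤ (algebraMap ℚ ℂ q) := hqC ▸ IsIntegral.sum _ fun σ _ => hint σ x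
    exact (isIntegral_algebraMap_iff (algebraMap ℚ ℂ).injective).1 this
  obtain ⟨n, hn⟩ := IsIntegrallyClosed.isIntegral_iff.1 hqi
  exact ⟨n, by rw [hqC, ← hn]; simp⟩

/-- The form `(x, y) ↦ Re ∑ σ x * conj (σ y)`, with `σ` ranging over the homomorphisms to `ℂ`. -/
noncomputable def canonicalForm (A : Type u) [CommRing A] [Fintype (A →+* ℂ)] : A →+ A →+ ℝ :=
  AddMonoidHom.mk' (fun x => AddMonoidHom.mk'
      (fun y => (∑ σ : A →+* ℂ, σ x * star (σ y)).re)
      fun y z => by simp [mul_add, Finset.sum_add_distrib])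
    fun x y => by ext z; simp [add_mul, Finset.sum_add_distrib]

variable [Fintype (A →+* ℂ)]

lemma canonicalForm_apply (x y : A) :
    canonicalForm A x y = (∑ σ : A →+* ℂ, σ x * star (σ y)).re := rfl

lemma canonicalForm_self (x : A) : canonicalForm A x x = ∑ σ : A →+* ℂ, ‖σ x‖ ^ 2 := by
  rw [canonicalForm_apply, Complex.re_sum]
  refine Finset.sum_congr rfl fun σ _ => ?_
  rw [Complex.star_def, Complex.mul_conj, Complex.ofReal_re, Complex.normSq_eq_norm_sq]

lemma isPosDefForm_canonicalForm [IsReduced A] [Module.Finite ℤ A] [Module.IsTorsionFree ℤ A] :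
    IsPosDefForm (canonicalForm A) where
  symm x y := by
    simp only [canonicalForm_apply, Complex.re_sum]
    refine Finset.sum_congr rfl fun σ _ => ?_
    simp; ring
  pos x hx := by
    obtain ⟨σ, hσ⟩ := exists_ringHom_complex_ne_zero hx
    rw [canonicalForm_self]
    exact Finset.sum_pos' (fun _ _ => by positivity) ⟨σ, Finset.mem_univ _, by positivity⟩

/-- A bound on the form bounds every `‖σ x‖`, hence the integer traces of `x * y` for `y` in a
finite generating set, and these traces determine `x`. -/
lemma finite_canonicalForm_le [IsReduced A] [Module.Finite ℤ A] [Module.IsTorsionFree ℤ A]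
    (c : ℝ) : {x | canonicalForm A x x ≤ c}.Finite := by
  classical
  obtain ⟨s, hs⟩ := Module.Finite.fg_top (R := ℤ) (M := A)
  choose T hT using exists_int_eq_sum_ringHom (A := A)
  have hTadd : ∀ x y, T (x + y) = T x + T y := fun x y => by
    have : ((T (x + y) : ℤ) : ℂ) = T x + T y := by
      rw [← hT, ← hT, ← hT, ← Finset.sum_add_distrib]; simp
    exact_mod_cast this
  let t : A →+ ℤ := AddMonoidHom.mk' T hTadd
  -- Nondegeneracy of the trace form: `∑ σ x • σ = 0` forces every `σ x = 0` by Dedekind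
  -- independence.
  have ht0 : ∀ x, (∀ y, T (x * y) = 0) → x = 0 := by
    intro x hx
    by_contra hx0
    obtain ⟨σ, hσ⟩ := exists_ringHom_complex_ne_zero hx0
    have hli : LinearIndependent ℂ (fun σ : A →+* ℂ => (σ : A → ℂ)) :=
      (linearIndependent_monoidHom A ℂ).comp (fun σ : A →+* ℂ => (σ : A →* ℂ))
        fun σ τ h => RingHom.ext fun x => DFunLike.congr_fun h x
    refine hσ (Fintype.linearIndependent_iff.1 hli (fun σ => σ x) ?_ σ)
    funext y
    have := hT (x * y)
    rw [hx y] at this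
    simpa using this
  let F : A → (s → ℤ) := fun x y => T (x * y)
  have hF : Function.Injective F := by
    intro x x' h
    rw [← sub_eq_zero]
    refine ht0 _ fun y => ?_
    have : (t.comp (AddMonoidHom.mulLeft (x - x'))).toIntLinearMap = 0 := by
      refine LinearMap.ext_on (s := (s : Set A)) hs fun y hy => ?_
      have h1 : t (x * y) = t (x' * y) := congrFun h ⟨y, hy⟩
      simp [sub_mul, h1]
    exact LinearMap.congr_fun this y
  let b : s → ℤ := fun y => ⌈∑ σ : A →+* ℂ, (|c| + 1) * ‖σ (y : A)‖⌉
  refine Set.Finite.of_finite_image (f := F) ?_ hF.injOn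
  refine (Set.finite_Icc (-b) b).subset ?_
  rintro _ ⟨x, hx, rfl⟩
  have hσ : ∀ σ : A →+* ℂ, ‖σ x‖ ≤ |c| + 1 := by
    intro σ
    have h1 : ‖σ x‖ ^ 2 ≤ c := by
      refine le_trans ?_ hx
      rw [canonicalForm_self]
      exact Finset.single_le_sum (f := fun σ : A →+* ℂ => ‖σ x‖ ^ 2)
        (fun _ _ => by positivity) (Finset.mem_univ σ)
    nlinarith [le_abs_self c, norm_nonneg (σ x)]
  have hb : ∀ y : s, |F x y| ≤ b y := by
    intro y
    have h1 : ((|F x y| : ℤ) : ℝ) ≤ ∑ σ : A →+* ℂ, (|c| + 1) * ‖σ (y : A)‖ := by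
      have : ((|F x y| : ℤ) : ℝ) = ‖((T (x * y) : ℤ) : ℂ)‖ := by
        rw [Complex.norm_intCast]; simp [F]
      rw [this, ← hT]
      refine (norm_sum_le _ _).trans (Finset.sum_le_sum fun σ _ => ?_)
      rw [map_mul, norm_mul]
      exact mul_le_mul_of_nonneg_right (hσ σ) (norm_nonneg _)
    exact_mod_cast h1.trans (Int.le_ceil _)
  exact ⟨fun y => (abs_le.1 (hb y)).1, fun y => (abs_le.1 (hb y)).2⟩

end Order

/-! ### Gradings are orthogonal for the canonical form -/

section Characters

/-- Characters with values in `ℚ / ℤ` separate the elements of an abelian group. -/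
lemma exists_monoidHom_addCircle_ne_one {G : Type v} [CommGroup G] {g : G} (hg : g ≠ 1) :
    ∃ χ : G →* Multiplicative (AddCircle (1 : ℚ)), χ g ≠ 1 := by
  obtain ⟨c, hc⟩ := CharacterModule.exists_character_apply_ne_zero_of_ne_zero
    (a := Additive.ofMul g) (by simpa using hg)
  exact ⟨AddMonoidHom.toMultiplicativeRight c, fun h => hc (congrArg Multiplicative.toAdd h)⟩

/-- The embedding of `ℚ / ℤ` as the roots of unity of the circle. -/
noncomputable def ratAddCircleToCircle : Multiplicative (AddCircle (1 : ℚ)) →* Circle :=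
  MonoidHom.mk' (fun x => AddCircle.toCircle (T := (1 : ℝ))
    (QuotientAddGroup.map (AddSubgroup.zmultiples (1 : ℚ)) (AddSubgroup.zmultiples (1 : ℝ))
      (Rat.castHom ℝ).toAddMonoidHom
      (by rw [AddSubgroup.zmultiples_le]; exact ⟨1, by simp⟩) x.toAdd))
    fun x y => by rw [toAdd_mul, map_add, AddCircle.toCircle_add]

lemma ratAddCircleToCircle_injective : Function.Injective ratAddCircleToCircle := by
  rw [injective_iff_map_eq_one]
  intro x hx
  obtain ⟨q, hq⟩ := QuotientAddGroup.mk_surjective x.toAdd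
  have h1 : AddCircle.toCircle (T := (1 : ℝ)) ((q : ℝ) : AddCircle (1 : ℝ)) = 1 := by
    rw [← hx]
    simp only [ratAddCircleToCircle, MonoidHom.mk'_apply, ← hq]
    rfl
  rw [← AddCircle.toCircle_zero] at h1
  have h2 := AddCircle.injective_toCircle one_ne_zero h1
  obtain ⟨n, hn⟩ := (AddCircle.coe_eq_zero_iff (1 : ℝ)).1 h2
  have hn' : (n : ℚ) = q := by
    have : (n : ℝ) = (q : ℝ) := by simpa using hn
    exact_mod_cast this
  have : x.toAdd = 0 := by
    rw [← hq]
    exact (AddCircle.coe_eq_zero_iff (1 : ℚ)).2 ⟨n, by simpa using hn'⟩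
  exact this

lemma exists_monoidHom_circle_ne {G : Type v} [CommGroup G] {g h : G} (hgh : g ≠ h) :
    ∃ χ : G →* Circle, χ g ≠ χ h := by
  obtain ⟨χ, hχ⟩ := exists_monoidHom_addCircle_ne_one (g := g / h) (by rwa [Ne, div_eq_one])
  refine ⟨ratAddCircleToCircle.comp χ, fun he => hχ ?_⟩
  have := ratAddCircleToCircle_injective he
  rw [map_div, this, div_self']

end Characters

section Orthogonality

variable {A : Type u} [CommRing A] {Γ : Type v} [CommGroup Γ] {C : Γ → AddSubgroup A}

lemma IsGrading.iSup_eq_top (hC : IsGrading C) : ⨆ γ, C γ = ⊤ :=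
  iSup_eq_top_of_isInternal hC.isInternal

lemma IsGrading.induction (hC : IsGrading C) {p : A → Prop} (h : ∀ γ, ∀ x ∈ C γ, p x)
    (h0 : p 0) (hadd : ∀ x y, p x → p y → p (x + y)) (x : A) : p x :=
  AddSubgroup.iSup_induction C (C := p) (hC.iSup_eq_top ▸ AddSubgroup.mem_top x) h h0 hadd

/-- A homomorphism to `ℂ` can be twisted by a character of the grading group. -/
lemma IsGrading.exists_twist (hC : IsGrading C) (χ : Γ →* Circle) (σ : A →+* ℂ) :
    ∃ τ : A →+* ℂ, ∀ γ, ∀ x ∈ C γ, τ x = χ γ * σ x := by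
  classical
  have hint : DirectSum.IsInternal C := by convert hC.isInternal
  let e : (DirectSum Γ fun γ => C γ) ≃+ A :=
    AddEquiv.ofBijective (DirectSum.coeAddMonoidHom C) hint
  let φ : A →+ ℂ := (DirectSum.toAddMonoid fun γ =>
    ((AddMonoidHom.mulLeft (χ γ : ℂ)).comp (σ : A →+ ℂ)).comp (C γ).subtype).comp
      e.symm.toAddMonoidHom
  have hφ : ∀ γ, ∀ x ∈ C γ, φ x = χ γ * σ x := by
    intro γ x hx
    have : e.symm x = DirectSum.of (fun γ => C γ) γ ⟨x, hx⟩ := by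
      rw [AddEquiv.symm_apply_eq]
      exact (DirectSum.coeAddMonoidHom_of C γ ⟨x, hx⟩).symm
    simp [φ, this]
  have hmul : ∀ x y, φ (x * y) = φ x * φ y := by
    intro x y
    refine hC.induction (p := fun x => φ (x * y) = φ x * φ y) (fun γ x hx => ?_) (by simp)
      (fun a b ha hb => by simp only [add_mul, map_add, ha, hb]) x
    refine hC.induction (p := fun y => φ (x * y) = φ x * φ y) (fun δ y hy => ?_) (by simp)
      (fun a b ha hb => by simp only [mul_add, map_add, ha, hb]) y
    rw [hφ _ _ (hC.mul_mem _ _ _ _ hx hy), hφ _ _ hx, hφ _ _ hy, map_mul, map_mul]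
    push_cast
    ring
  -- The grading axioms do not place `1` in degree `1`, so `φ 1` is only known to be idempotent;
  -- were it `0`, then `φ`, and with it `σ`, would vanish on every piece.
  have hone : φ 1 = 1 := by
    have h1 : IsIdempotentElem (φ 1) := by rw [IsIdempotentElem, ← hmul, one_mul]
    rcases IsIdempotentElem.iff_eq_zero_or_one.1 h1 with h | h
    · have hσ : σ 1 = 0 := by
        refine hC.induction (p := fun x => σ x = 0) (fun γ x hx => ?_) (by simp)
          (fun a b ha hb => by simp [ha, hb]) 1
        have h2 : φ x = 0 := by rw [← one_mul x, hmul, h, zero_mul]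
        rw [hφ γ x hx] at h2
        exact (mul_eq_zero.1 h2).resolve_left (Circle.coe_ne_zero _)
      simp at hσ
    · exact h
  exact ⟨{ φ with map_one' := hone, map_mul' := hmul }, hφ⟩

lemma IsGrading.isOrtho [Fintype (A →+* ℂ)] (hC : IsGrading C) :
    IsOrtho (canonicalForm A) C := by
  intro γ δ hne x hx y hy
  obtain ⟨χ, hχ⟩ := exists_monoidHom_circle_ne hne
  choose t ht using fun σ : A →+* ℂ => hC.exists_twist χ σ
  have hinj : Function.Injective t := by
    intro σ σ' h
    refine RingHom.ext fun z => ?_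
    refine hC.induction (p := fun z => σ z = σ' z) (fun γ z hz => ?_) (by simp)
      (fun a b ha hb => by simp [ha, hb]) z
    have h1 := ht σ γ z hz
    rw [h, ht σ' γ z hz] at h1
    exact (mul_left_cancel₀ (Circle.coe_ne_zero _) h1).symm
  set s : ℂ := ∑ σ : A →+* ℂ, σ x * star (σ y) with hs
  have h1 : s = χ γ * star (χ δ : ℂ) * s := by
    conv_lhs => rw [hs, ← (Finite.injective_iff_bijective.1 hinj).sum_comp]
    rw [hs, Finset.mul_sum]
    refine Finset.sum_congr rfl fun σ _ => ?_
    rw [ht σ γ x hx, ht σ δ y hy, star_mul']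
    ring
  have h2 : (χ γ * star (χ δ : ℂ) : ℂ) ≠ 1 := by
    intro h
    refine hχ (Circle.ext ?_)
    have h3 : star (χ δ : ℂ) * χ δ = 1 := by
      rw [Complex.star_def, mul_comm, Complex.mul_conj, Circle.normSq_coe, Complex.ofReal_one]
    calc (χ γ : ℂ) = χ γ * (star (χ δ : ℂ) * χ δ) := by rw [h3, mul_one]
      _ = χ δ := by rw [← mul_assoc, h, one_mul]
  have h4 : s = 0 := by
    have : (χ γ * star (χ δ : ℂ) - 1) * s = 0 := by rw [sub_mul, ← h1]; ring
    exact (mul_eq_zero.1 this).resolve_left (sub_ne_zero.2 h2)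
  rw [canonicalForm_apply, ← hs, h4, Complex.zero_re]

end Orthogonality

/-! ### The universal grading -/

section Universal

variable {A : Type u} [CommRing A]

lemma IsPosDefForm.eq_of_mem_of_mem {M : Type u} [AddCommGroup M] {β : M →+ M →+ ℝ}
    (hβ : IsPosDefForm β) {κ : Type v} {C : κ → AddSubgroup M} (hC : IsOrtho β C) {x : M}
    (hx : x ≠ 0) {i j : κ} (hi : x ∈ C i) (hj : x ∈ C j) : i = j := by
  by_contra hij
  exact hx (hβ.eq_zero (hC i j hij x hi x hj))

/-- The relations `e i * e j = e k`, one whenever `L i * L j` is not orthogonal to `L k`. -/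
def gradingRels {ι : Type v} (β : A →+ A →+ ℝ) (L : ι → AddSubgroup A) : Set (FreeGroup ι) :=
  {r | ∃ i j k, (∃ x ∈ L i, ∃ y ∈ L j, ∃ z ∈ L k, β (x * y) z ≠ 0) ∧
    r = FreeGroup.of i * FreeGroup.of j * (FreeGroup.of k)⁻¹}

/-- The abelian group generated by the index set of `L`, subject to `gradingRels`. -/
abbrev GradingGroup {ι : Type v} (β : A →+ A →+ ℝ) (L : ι → AddSubgroup A) : Type v :=
  Abelianization (PresentedGroup (gradingRels β L))

/-- The generators of `GradingGroup`. -/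
def gradingGen {ι : Type v} (β : A →+ A →+ ℝ) (L : ι → AddSubgroup A) (i : ι) :
    GradingGroup β L :=
  Abelianization.of (PresentedGroup.of i)

/-- Coarsening of the decomposition `L` along a map of the index set. -/
def coarsen {ι : Type*} {Γ : Type*} (e : ι → Γ) (L : ι → AddSubgroup A) (γ : Γ) : AddSubgroup A :=
  ⨆ (i) (_ : e i = γ), L i

lemma le_coarsen {ι : Type*} {Γ : Type*} (e : ι → Γ) (L : ι → AddSubgroup A) (i : ι) :
    L i ≤ coarsen e L (e i) :=
  le_iSup₂_of_le i rfl le_rfl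

variable {ι : Type v} {β : A →+ A →+ ℝ} {L : ι → AddSubgroup A}

lemma iSup_coarsen {Γ : Type*} (e : ι → Γ) (h : ⨆ i, L i = ⊤) : ⨆ γ, coarsen e L γ = ⊤ := by
  rw [eq_top_iff, ← h]
  exact iSup_le fun i => (le_coarsen e L i).trans (le_iSup (coarsen e L) (e i))

lemma IsPosDefForm.isOrtho_coarsen (hβ : IsPosDefForm β) (hL : IsOrtho β L) {Γ : Type*}
    (e : ι → Γ) : IsOrtho β (coarsen e L) := by
  intro γ δ hne x hx y hy
  refine form_eq_zero_of_mem_biSup hβ hx hy ?_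
  rintro i j rfl rfl
  exact hL i j fun h => hne (congrArg e h)

lemma gradingGen_mul {i j k : ι} {x y z : A} (hx : x ∈ L i) (hy : y ∈ L j) (hz : z ∈ L k)
    (h : β (x * y) z ≠ 0) : gradingGen β L i * gradingGen β L j = gradingGen β L k := by
  rw [← mul_inv_eq_one]
  simp only [gradingGen, ← map_inv, ← map_mul]
  rw [show PresentedGroup.of (rels := gradingRels β L) i * PresentedGroup.of j *
    (PresentedGroup.of k)⁻¹ = 1 from
      PresentedGroup.one_of_mem ⟨i, j, k, ⟨x, hx, y, hy, z, hz, h⟩, rfl⟩, map_one]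

lemma closure_range_gradingGen : Subgroup.closure (Set.range (gradingGen β L)) = ⊤ := by
  have h1 : Set.range (gradingGen β L) =
      (Abelianization.of : PresentedGroup (gradingRels β L) →* _) ''
        Set.range PresentedGroup.of := by
    rw [← Set.range_comp]; rfl
  rw [h1, ← MonoidHom.map_closure, PresentedGroup.closure_range_of, ← MonoidHom.range_eq_map,
    MonoidHom.range_eq_top]
  exact QuotientGroup.mk_surjective

lemma gradingGroup_hom_ext {Δ : Type*} [CommGroup Δ] {f g : GradingGroup β L →* Δ}
    (h : ∀ i, f (gradingGen β L i) = g (gradingGen β L i)) : f = g :=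
  MonoidHom.eq_of_eqOn_dense closure_range_gradingGen (by rintro _ ⟨i, rfl⟩; exact h i)

/-- If a product from `L i * L j` is not orthogonal to `L k`, a defining relation gives `k` the
degree of the product; `IsPosDefForm.mem_biSup` then places the product. -/
lemma IsPosDefForm.isGrading_coarsen (hβ : IsPosDefForm β) (hL : IsOrtho β L)
    (h : ⨆ i, L i = ⊤) : IsGrading (coarsen (gradingGen β L) L) where
  mul_mem γ γ' x y hx hy := by
    have base : ∀ i j, ∀ x ∈ L i, ∀ y ∈ L j,
        x * y ∈ coarsen (gradingGen β L) L (gradingGen β L i * gradingGen β L j) := by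
      intro i j x hx y hy
      refine hβ.mem_biSup hL h fun k hk z hz => ?_
      by_contra hne
      exact hk (gradingGen_mul hx hy hz hne).symm
    have step : ∀ i, ∀ x ∈ L i, ∀ y ∈ coarsen (gradingGen β L) L γ',
        x * y ∈ coarsen (gradingGen β L) L (gradingGen β L i * γ') := by
      intro i x hx y hy
      have : coarsen (gradingGen β L) L γ' ≤
          (coarsen (gradingGen β L) L (gradingGen β L i * γ')).comap (AddMonoidHom.mulLeft x) := by
        refine iSup₂_le ?_
        rintro j rfl y hy
        exact base i j x hx y hy
      exact this hy
    have : coarsen (gradingGen β L) L γ ≤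
        (coarsen (gradingGen β L) L (γ * γ')).comap (AddMonoidHom.mulRight y) := by
      refine iSup₂_le ?_
      rintro i rfl x hx
      exact step i x hx y hy
    exact this hx
  isInternal := hβ.isInternal (hβ.isOrtho_coarsen hL _) (iSup_coarsen _ h)

lemma iSup_pushforward {Γ : Type*} [CommGroup Γ] {Δ : Type*} [CommGroup Δ] (f : Γ →* Δ)
    {B : Γ → AddSubgroup A} (h : ⨆ γ, B γ = ⊤) : ⨆ δ, pushforward f B δ = ⊤ :=
  iSup_coarsen f h

/-- A power of an element in a nonzero piece stays in a nonzero piece, so the degrees of the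
nonzero pieces are torsion when there are finitely many of them. -/
lemma IsGrading.isOfFinOrder [IsReduced A] {Γ : Type v} [CommGroup Γ] {B : Γ → AddSubgroup A}
    (hB : IsGrading B) (hfin : {γ | B γ ≠ ⊥}.Finite) {γ : Γ} (hγ : B γ ≠ ⊥) :
    IsOfFinOrder γ := by
  obtain ⟨⟨x, hx⟩, hx0⟩ := AddSubgroup.ne_bot_iff_exists_ne_zero.1 hγ
  have hx0' : x ≠ 0 := fun h => hx0 (Subtype.ext h)
  have hpow : ∀ n : ℕ, x ^ (n + 1) ∈ B (γ ^ (n + 1)) := by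
    intro n
    induction n with
    | zero => simpa using hx
    | succ n ih => rw [pow_succ x, pow_succ γ]; exact hB.mul_mem _ _ _ _ ih hx
  rw [← finite_powers]
  refine (hfin.union (Set.finite_singleton 1)).subset ?_
  rintro _ ⟨n, rfl⟩
  cases n with
  | zero => right; simp
  | succ n =>
    left
    intro hbot
    have h1 := hpow n
    simp only at hbot
    rw [hbot, AddSubgroup.mem_bot] at h1
    exact pow_ne_zero _ hx0' h1

lemma IsPosDefForm.finite_gradingGroup [IsReduced A] [Finite ι] (hβ : IsPosDefForm β)
    (hL : IsOrtho β L) (h : ⨆ i, L i = ⊤) (hne : ∀ i, L i ≠ ⊥) : Finite (GradingGroup β L) := by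
  have hfg : Group.FG (GradingGroup β L) :=
    Group.fg_iff.2 ⟨_, closure_range_gradingGen, Set.finite_range _⟩
  have hsupp : {γ | coarsen (gradingGen β L) L γ ≠ ⊥}.Finite := by
    refine (Set.finite_range (gradingGen β L)).subset fun γ hγ => ?_
    by_contra hc
    refine hγ (le_bot_iff.1 (iSup₂_le fun i hi => absurd ⟨i, hi⟩ hc))
  have htors : ∀ i, IsOfFinOrder (gradingGen β L i) := fun i =>
    (hβ.isGrading_coarsen hL h).isOfFinOrder hsupp fun hb =>
      hne i (le_bot_iff.1 (hb ▸ le_coarsen (gradingGen β L) L i))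
  have htop : CommGroup.torsion (GradingGroup β L) = ⊤ := by
    rw [eq_top_iff, ← closure_range_gradingGen, Subgroup.closure_le]
    rintro _ ⟨i, rfl⟩
    exact htors i
  refine CommGroup.finite_of_fg_isMulTorsion _ fun g => ?_
  have : g ∈ CommGroup.torsion (GradingGroup β L) := htop ▸ Subgroup.mem_top g
  exact this

/-- The generator `i` must go to the degree `d i` of the piece of `C` containing `L i`, which is
unique as `L i ≠ ⊥`. The relations hold because distinct pieces of `C` are orthogonal. -/
lemma IsPosDefForm.existsUnique_pushforward (hβ : IsPosDefForm β)
    (h : ⨆ i, L i = ⊤) (hne : ∀ i, L i ≠ ⊥) {Δ : Type w} [CommGroup Δ] {C : Δ → AddSubgroup A}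
    (hC : IsGrading C) (hCo : IsOrtho β C) (hle : ∀ i, ∃ δ, L i ≤ C δ) :
    ∃! f : GradingGroup β L →* Δ, C = pushforward f (coarsen (gradingGen β L) L) := by
  choose d hd using hle
  have hrel : ∀ r ∈ gradingRels β L, FreeGroup.lift d r = 1 := by
    rintro _ ⟨i, j, k, ⟨x, hx, y, hy, z, hz, hxyz⟩, rfl⟩
    have : d i * d j = d k := by
      by_contra hc
      exact hxyz (hCo _ _ hc _ (hC.mul_mem _ _ _ _ (hd i hx) (hd j hy)) _ (hd k hz))
    simp [this]
  let f : GradingGroup β L →* Δ := Abelianization.lift (PresentedGroup.toGroup hrel)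
  have hf : ∀ i, f (gradingGen β L i) = d i := fun i => by
    simp [f, gradingGen]
  refine ⟨f, ?_, fun g hg => gradingGroup_hom_ext fun i => ?_⟩
  · refine hβ.eq_of_le hCo (iSup_pushforward f (iSup_coarsen _ h)) fun δ => ?_
    refine iSup₂_le ?_
    rintro γ rfl
    refine iSup₂_le ?_
    rintro i rfl
    rw [hf i]
    exact hd i
  · obtain ⟨⟨x, hx⟩, hx0⟩ := AddSubgroup.ne_bot_iff_exists_ne_zero.1 (hne i)
    have hx0' : x ≠ 0 := fun h => hx0 (Subtype.ext h)
    rw [hf i]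
    refine hβ.eq_of_mem_of_mem hCo hx0' ?_ (hd i hx)
    rw [hg]
    exact le_iSup₂_of_le (f := fun γ (_ : g γ = g (gradingGen β L i)) =>
      coarsen (gradingGen β L) L γ) _ rfl le_rfl (le_coarsen _ L i hx)

/-- A reduced order has a universal grading by a finite group. -/
theorem exists_finite_universalGrading (A : Type u) [CommRing A] [IsReduced A] [Module.Finite ℤ A]
    [Module.IsTorsionFree ℤ A] :
    ∃ (Γ : Type v) (_ : CommGroup Γ) (B : Γ → AddSubgroup A),
      Finite Γ ∧ IsUniversalGrading.{u, v, w} B := by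
  have := finite_ringHom_complex (A := A)
  let := Fintype.ofFinite (A →+* ℂ)
  have hβ := isPosDefForm_canonicalForm (A := A)
  obtain ⟨ι, hι, L, hL, htop, hne, hmin⟩ :=
    IsPosDefForm.exists_finest.{u, v, w} hβ finite_canonicalForm_le
  exact ⟨GradingGroup (canonicalForm A) L, inferInstance, coarsen (gradingGen _ L) L,
    hβ.finite_gradingGroup hL htop hne, hβ.isGrading_coarsen hL htop, fun Δ _ C hC =>
      hβ.existsUnique_pushforward htop hne hC hC.isOrtho (hmin Δ C hC.isOrtho hC.iSup_eq_top)⟩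

/-- Every ring is graded with all its elements in degree `1`. -/
lemma isGrading_trivial {Δ : Type w} [CommGroup Δ] :
    IsGrading (fun δ : Δ => ⨆ (_ : δ = 1), (⊤ : AddSubgroup A)) where
  mul_mem γ γ' x y hx hy := by
    by_cases hγ : γ = 1 <;> by_cases hγ' : γ' = 1 <;> simp_all
  isInternal := by
    refine isInternal_of_iSupIndep (fun i => ?_) (eq_top_iff.2 (le_iSup_of_le 1 (by simp)))
    by_cases hi : i = 1
    · have : (⨆ (j : Δ) (_ : j ≠ i), ⨆ (_ : j = 1), (⊤ : AddSubgroup A)) = ⊥ :=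
        le_bot_iff.1 (iSup₂_le fun j hj => iSup_le fun h => absurd (h.trans hi.symm) hj)
      rw [this]
      exact disjoint_bot_right
    · simp [hi]

/-- The degrees of the nonzero pieces of a universal grading generate the grading group. -/
lemma IsUniversalGrading.closure_support {Γ : Type v} [CommGroup Γ] {B : Γ → AddSubgroup A}
    (hB : IsUniversalGrading.{u, v, w} B) : Subgroup.closure {γ | B γ ≠ ⊥} = ⊤ := by
  set H := Subgroup.closure {γ | B γ ≠ ⊥} with hH
  by_contra hne
  obtain ⟨g, hg⟩ : ∃ g, g ∉ H := by
    by_contra! hc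
    exact hne (eq_top_iff.2 fun x _ => hc x)
  obtain ⟨χ, hχ⟩ := exists_monoidHom_addCircle_ne_one (g := (g : Γ ⧸ H))
    (fun h => hg ((QuotientGroup.eq_one_iff g).1 h))
  -- `ψ` is nontrivial but kills the support, so `ψ` and `1` both push `B` forward to the trivial
  -- grading, against uniqueness. `ULift` brings the target into the tested universe.
  let ψ : Γ →* ULift.{w} (Multiplicative (AddCircle (1 : ℚ))) :=
    (MulEquiv.ulift.symm.toMonoidHom.comp χ).comp (QuotientGroup.mk' H)
  have hψ : ∀ γ, B γ ≠ ⊥ → ψ γ = 1 := by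
    intro γ hγ
    have : (γ : Γ ⧸ H) = 1 := (QuotientGroup.eq_one_iff γ).2 (Subgroup.subset_closure hγ)
    simp [ψ, this]
  have hpush : pushforward ψ B = pushforward (1 : Γ →* ULift.{w} (Multiplicative _)) B := by
    funext δ
    refine le_antisymm (iSup₂_le fun γ hγ => ?_) (iSup₂_le fun γ hγ => ?_)
    all_goals
      by_cases hb : B γ = ⊥
      · simp [hb]
    · exact le_iSup₂_of_le γ (by rw [← hγ, hψ γ hb]; rfl) le_rfl
    · exact le_iSup₂_of_le γ (by rw [← hγ, hψ γ hb]; rfl) le_rfl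
  have htriv : (fun δ => ⨆ (_ : δ = 1), ⊤) =
      pushforward (1 : Γ →* ULift.{w} (Multiplicative (AddCircle (1 : ℚ)))) B := by
    funext δ
    by_cases hδ : δ = 1
    · subst hδ
      simp [pushforward, hB.1.iSup_eq_top]
    · have hδ' : ¬ 1 = δ := fun h => hδ h.symm
      simp [pushforward, hδ, hδ']
  have h1 : ψ = 1 := (hB.2 _ _ isGrading_trivial).unique (htriv.trans hpush.symm) htriv
  have h2 : ψ g = 1 := by rw [h1]; rfl
  exact hχ (MulEquiv.ulift.symm.injective (h2.trans (map_one _).symm))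

/-- A universal grading of a reduced order has a finite grading group. -/
theorem IsUniversalGrading.finite [IsReduced A] [Module.Finite ℤ A] [Module.IsTorsionFree ℤ A]
    {Γ : Type v} [CommGroup Γ] {B : Γ → AddSubgroup A}
    (hB : IsUniversalGrading.{u, v, w} B) : Finite Γ := by
  -- `B` is tested only against `Type w`, which need not contain `Γ₀`, so no inverse map is sought:
  -- `Γ₀` is tested against `Type v`, and surjectivity of `g` suffices.
  obtain ⟨Γ₀, _, B₀, hfin, -, huniv⟩ := exists_finite_universalGrading.{u, 0, v} A
  obtain ⟨g, hg, -⟩ := huniv Γ B hB.1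
  have hrange : g.range = ⊤ := by
    rw [eq_top_iff, ← hB.closure_support, Subgroup.closure_le]
    intro γ hγ
    by_contra hc
    refine hγ ?_
    rw [hg]
    exact le_bot_iff.1 (iSup₂_le fun γ₀ h₀ => absurd ⟨γ₀, h₀⟩ hc)
  exact Finite.of_surjective g (MonoidHom.range_eq_top.1 hrange)

end Universal

end RingGrading

theorem theorem1p1 (A : Type u) [CommRing A] [IsReduced A] (hA : RingGrading.IsOrder A) :
    (∃ (Γ : Type v) (_ : CommGroup Γ) (B : Γ → AddSubgroup A),
      Finite Γ ∧ RingGrading.IsUniversalGrading.{u, v, w} B) ∧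
    (∀ (Γ : Type v) [CommGroup Γ] (B : Γ → AddSubgroup A),
      RingGrading.IsUniversalGrading.{u, v, w} B → Finite Γ) := by
  obtain ⟨n, ⟨e⟩⟩ := hA
  have hfree : Module.Free ℤ A := Module.Free.of_equiv e.symm.toIntLinearEquiv
  have hfin : Module.Finite ℤ A := Module.Finite.equiv e.symm.toIntLinearEquiv
  have htf : Module.IsTorsionFree ℤ A := inferInstance
  exact ⟨RingGrading.exists_finite_universalGrading A, fun Γ _ B hB => hB.finite⟩
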